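/- Let $p\ge 1$ be an integer, $\xi>0$, $\gamma\ge 0$ with $2\gamma+\frac{1}{\xi(p+1)}<1$. There is a constant $C>0$ depending only on $p,\xi,\gamma$ such that the following holds for every $n$, with $\|\cdot\|$ the Euclidean norm on $\mathbb{R}^n$. Let $f:\mathbb{R}^n\to\mathbb{R}$ be convex and $p$ times continuously differentiable with $L_p$-Lipschitz $p$-th derivative (in operator norm), let $x_*$ be a minimizer of $f$, and let $H_p=\xi L_p$. Put $$\tilde\Omega(x;y)=f(x)+\sum_{j=1}^{p}\frac{1}{j!}D^jf(x)[y-x]^j+\frac{H_p}{p!}\|y-x\|^{p+1},$$ $$\mathcal N^{\gamma}(x)=\{T\in\mathbb{R}^n:\ \|\nabla_T\tilde\Omega(x;T)\|\le\gamma\|\nabla f(T)\|\}.$$ Consider any run of $K$ iterations of the Inexact Near-optimal Accelerated Tensor Method: $A_0=0$, $x_0=y_0\in\mathbb{R}^n$ and, for $k=0,\dots,K-1$, a pair $\lambda_{k+1}>0$, $y_{k+1}\in\mathbb{R}^n$ is chosen such that $$\frac12\le\lambda_{k+1}\frac{H_p\|y_{k+1}-\tilde x_k\|^{p-1}}{(p-1)!}\le\frac{p}{p+1},\qquad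 y_{k+1}\in\mathcal N^{\gamma}(\tilde x_k),$$ where $$a_{k+1}=\frac{\lambda_{k+1}+\sqrt{\lambda_{k+1}^2+4\lambda_{k+1}A_k}}{2},\quad A_{k+1}=A_k+a_{k+1},\quad \tilde x_k=\frac{A_k}{A_{k+1}}y_k+\frac{a_{k+1}}{A_{k+1}}x_k,$$ and then $x_{k+1}=x_k-a_{k+1}\nabla f(y_{k+1})$. Then, with $R=\|x_0-x_*\|$, for all $1\le k\le K$, $$f(y_k)-f(x_*)\le C\,\frac{H_pR^{p+1}}{k^{(3p+1)/2}};$$ in particular $f(y_k)-f(x_*)\le\tilde O\big(H_pR^{p+1}/k^{(3p+1)/2}\big)$. -/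

import Mathlib

open scoped NNReal

/-- The `p`-th order Taylor approximation of `f` at `x`, evaluated at `y`:
`f(x) + ∑_{k=1}^p (1/k!) D^k f(x)[y - x]^k` (the term `k = 0` of the sum is `f(x)`). -/
noncomputable def taylorModel {n : ℕ} (p : ℕ) (f : EuclideanSpace ℝ (Fin n) → ℝ)
    (x y : EuclideanSpace ℝ (Fin n)) : ℝ :=
  ∑ k ∈ Finset.range (p + 1),
    (1 / (Nat.factorial k : ℝ)) * iteratedFDeriv ℝ k f x (fun _ => y - x)

/-- The regularized Taylor model: the Taylor approximation plus `(H / p!) ‖y - x‖^(p+1)`. -/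
noncomputable def regularizedModel {n : ℕ} (p : ℕ) (H : ℝ) (f : EuclideanSpace ℝ (Fin n) → ℝ)
    (x y : EuclideanSpace ℝ (Fin n)) : ℝ :=
  taylorModel p f x y + H / (Nat.factorial p : ℝ) * ‖y - x‖ ^ (p + 1)

/-- The set of `γ`-inexact solutions of the subproblem at `x`: the points `T` at which the
gradient (in `T`) of the regularized model has norm at most `γ ‖∇f(T)‖`. -/
def inexactSolutions {n : ℕ} (p : ℕ) (H γ : ℝ) (f : EuclideanSpace ℝ (Fin n) → ℝ)
    (x : EuclideanSpace ℝ (Fin n)) : Set (EuclideanSpace ℝ (Fin n)) :=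
  {T | ‖gradient (fun y => regularizedModel p H f x y) T‖ ≤ γ * ‖gradient f T‖}

/-- The sequences form a run of `K` iterations of the inexact `p`-th order near-optimal
accelerated tensor method for `f`, with regularization constant `H` and accuracy `γ`
(`lam` is `λ`, `xt` is `x̃`). The step `(λ_{k+1}, y_{k+1})` is any pair that meets the
line-search condition and the inexactness condition. -/
structure IsNATMIRun {n : ℕ} (p : ℕ) (H γ : ℝ) (f : EuclideanSpace ℝ (Fin n) → ℝ) (K : ℕ)
    (A a lam : ℕ → ℝ) (x y xt : ℕ → EuclideanSpace ℝ (Fin n)) : Prop where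
  A_zero : A 0 = 0
  y_zero : x 0 = y 0
  lam_pos : ∀ k < K, 0 < lam (k + 1)
  step_lower : ∀ k < K,
    1 / 2 ≤ lam (k + 1) * (H * ‖y (k + 1) - xt k‖ ^ (p - 1) / (Nat.factorial (p - 1) : ℝ))
  step_upper : ∀ k < K,
    lam (k + 1) * (H * ‖y (k + 1) - xt k‖ ^ (p - 1) / (Nat.factorial (p - 1) : ℝ))
      ≤ (p : ℝ) / ((p : ℝ) + 1)
  y_mem : ∀ k < K, y (k + 1) ∈ inexactSolutions p H γ f (xt k)
  a_succ : ∀ k < K,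
    a (k + 1) = (lam (k + 1) + Real.sqrt (lam (k + 1) ^ 2 + 4 * lam (k + 1) * A k)) / 2
  A_succ : ∀ k < K, A (k + 1) = A k + a (k + 1)
  xt_eq : ∀ k < K, xt k = (A k / A (k + 1)) • y k + (a (k + 1) / A (k + 1)) • x k
  x_succ : ∀ k < K, x (k + 1) = x k - a (k + 1) • gradient f (y (k + 1))

/-!
The method is an accelerated inexact proximal point method in disguise, and its rate follows from
how fast the weights `A k` are forced to grow.

Differentiating the Taylor model of `f` gives the Taylor model of `∇f`, whose error at `T` is at most
`L / p! ‖T - x‖^p` (`norm_sub_taylorSum_le`). Hence at an inexact solution `T` of the subproblem at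
`x`, the gradient `∇f(T)` is `-c (T - x)` up to a relative error, where `c (T - x)` is the gradient of
the regularizer. The line-search condition puts `λ c` into `[1/2, 1]`, and `2γ + 1/(ξ(p+1)) < 1` then
yields `‖λ ∇f(T) + (T - x)‖ ≤ τ ‖T - x‖` with a constant `τ < 1` (`IsNATMIRun.residual_le`).

With this error bound, convexity shows that `A_k (f(y_k) - f(x⋆)) + ‖x_k - x⋆‖² / 2` decreases, and
drops in each step by at least `(1 - τ²)/2 · A_{k+1}/λ_{k+1} · r_k²`, where `r_k = ‖y_{k+1} - x̃_k‖`
(`IsNATMIRun.potential_le`). So `f(y_k) - f(x⋆) ≤ R² / (2 A_k)`, and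
`∑ A_{i+1}/λ_{i+1} · r_i² ≤ R² / (1 - τ²)`.

It remains to bound `A_k` from below by a multiple of `k^((3p+1)/2) / (H R^(p-1))`
(`weight_growth`). The line search makes `λ_{i+1} r_i^(p-1)` at least a multiple of `1/H`, and
`2 √A_k ≥ ∑ √λ_i`. Hölder's inequality combines these with the bounded sum into
`∑_{i≤k} A_i^((p-1)/(3p+1)) ≤ const · A_k^((p+1)/(3p+1))`, a discrete differential inequality whose
solutions grow at the stated rate, without logarithmic factors.
-/

/-! ### Taylor expansion with a Lipschitz derivative -/

universe u

section Taylor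

variable {E F : Type u} [NormedAddCommGroup E] [NormedSpace ℝ E] [NormedAddCommGroup F]
  [NormedSpace ℝ F]

/-- The `k`-th derivative of a `C^k` map, evaluated at `k - 1` copies of `d` and one `h`, does not
depend on the slot of `h`. In the induction, all slots but the last agree by the case of `fderiv g`
(differentiating first), all slots but the first agree by the case of `g` (differentiating last),
and for `k ≥ 3` these two ranges of slots overlap; `k = 2` is the symmetry of second derivatives. -/
theorem iteratedFDeriv_update_const_eq {k : ℕ} {g : E → F} (hg : ContDiff ℝ k g) (x d h : E)
    (i j : Fin k) :
    iteratedFDeriv ℝ k g x (Function.update (fun _ => d) i h) =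
      iteratedFDeriv ℝ k g x (Function.update (fun _ => d) j h) := by
  induction k generalizing F x with
  | zero => exact i.elim0
  | succ k ih =>
    have hg' : ContDiff ℝ k (fun y => fderiv ℝ g y) :=
      hg.fderiv_right (by norm_cast)
    have hgk : ContDiff ℝ k g := hg.of_le (by exact_mod_cast Nat.le_succ k)
    have hdiff : DifferentiableAt ℝ (iteratedFDeriv ℝ k g) x :=
      (hg.differentiable_iteratedFDeriv (by exact_mod_cast Nat.lt_succ_self k)) x
    have hcast : ∀ i j : Fin k,
        iteratedFDeriv ℝ (k + 1) g x (Function.update (fun _ => d) i.castSucc h) =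
          iteratedFDeriv ℝ (k + 1) g x (Function.update (fun _ => d) j.castSucc h) := by
      intro i j
      have hlast : ∀ i : Fin k, Function.update (fun _ : Fin (k + 1) => d) i.castSucc h
          (Fin.last k) = d := fun i => Function.update_of_ne (Fin.castSucc_lt_last i).ne' _ _
      rw [iteratedFDeriv_succ_apply_right, iteratedFDeriv_succ_apply_right,
        Fin.init_update_castSucc, Fin.init_update_castSucc, hlast, hlast]
      exact congrArg (fun T : E →L[ℝ] F => T d) (ih hg' x i j)
    have hsucc : ∀ i j : Fin k,
        iteratedFDeriv ℝ (k + 1) g x (Function.update (fun _ => d) i.succ h) =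
          iteratedFDeriv ℝ (k + 1) g x (Function.update (fun _ => d) j.succ h) := by
      have key : ∀ m : Fin k → E, fderiv ℝ (iteratedFDeriv ℝ k g) x d m =
          fderiv ℝ (fun y => iteratedFDeriv ℝ k g y m) x d := by
        intro m
        exact (fderiv_continuousMultilinear_apply_const_apply hdiff m d).symm
      intro i j
      have hzero : ∀ i : Fin k, Function.update (fun _ : Fin (k + 1) => d) i.succ h 0 = d :=
        fun i => Function.update_of_ne (Fin.succ_ne_zero i).symm _ _
      rw [iteratedFDeriv_succ_apply_left, iteratedFDeriv_succ_apply_left,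
        Fin.tail_update_succ, Fin.tail_update_succ, hzero, hzero]
      change fderiv ℝ (iteratedFDeriv ℝ k g) x d (Function.update (fun _ => d) i h) =
        fderiv ℝ (iteratedFDeriv ℝ k g) x d (Function.update (fun _ => d) j h)
      rw [key, key]
      congr 1
      congr 1
      funext y
      exact ih hgk y i j
    match k with
    | 0 => rw [show i = j from Fin.ext (by omega)]
    | 1 =>
      have hsymm : IsSymmSndFDerivAt ℝ g x :=
        hg.contDiffAt.isSymmSndFDerivAt (by simp)
      have h01 : iteratedFDeriv ℝ (1 + 1) g x (Function.update (fun _ => d) 0 h) =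
          iteratedFDeriv ℝ (1 + 1) g x (Function.update (fun _ => d) 1 h) := by
        have := hsymm d h
        rw [iteratedFDeriv_two_apply, iteratedFDeriv_two_apply]
        simpa using this.symm
      fin_cases i <;> fin_cases j <;> first | rfl | exact h01 | exact h01.symm
    | k + 2 =>
      have aux : ∀ i : Fin (k + 2 + 1),
          iteratedFDeriv ℝ (k + 2 + 1) g x (Function.update (fun _ => d) i h) =
            iteratedFDeriv ℝ (k + 2 + 1) g x
              (Function.update (fun _ => d) (Fin.castSucc 1) h) := by
        intro i
        induction i using Fin.cases with
        | zero => exact hcast 0 1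
        | succ i => exact hsucc i 0
      rw [aux i, aux j]

/-- The Taylor polynomial of degree `m` at `x` of a vector-valued map `g`, evaluated at `y`. For
real-valued maps it is definitionally `taylorModel`; general targets are needed in order to expand
`fderiv ℝ f` as well as `f`. -/
noncomputable def taylorSum (m : ℕ) (g : E → F) (x y : E) : F :=
  ∑ k ∈ Finset.range (m + 1), (1 / (Nat.factorial k : ℝ)) • iteratedFDeriv ℝ k g x (fun _ => y - x)

@[simp]
theorem taylorSum_self (m : ℕ) (g : E → F) (x : E) : taylorSum m g x x = g x := by
  rw [taylorSum, Finset.sum_range_succ', Finset.sum_eq_zero, zero_add]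
  · simp
  · intro k _
    rw [ContinuousMultilinearMap.map_coord_zero _ (0 : Fin (k + 1)) (sub_self x), smul_zero]

/-- The derivative in `z` of the homogeneous Taylor term of degree `k + 1` of `g` is the Taylor term
of degree `k` of `fderiv ℝ g`. -/
theorem hasFDerivAt_iteratedFDeriv_diag {k : ℕ} {g : E → F} (hg : ContDiff ℝ (k + 1 : ℕ) g)
    (x y : E) :
    HasFDerivAt (fun z => (1 / (Nat.factorial (k + 1) : ℝ)) •
        iteratedFDeriv ℝ (k + 1) g x (fun _ => z - x))
      ((1 / (Nat.factorial k : ℝ)) • iteratedFDeriv ℝ k (fderiv ℝ g) x (fun _ => y - x)) y := by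
  have h1 := HasFDerivAt.multilinear_comp (f := iteratedFDeriv ℝ (k + 1) g x)
    (g := fun _ z => z - x) (g' := fun _ => ContinuousLinearMap.id ℝ E) (x := y)
    (fun _ => (hasFDerivAt_id y).sub_const x)
  refine (h1.const_smul (1 / (Nat.factorial (k + 1) : ℝ))).congr_fderiv ?_
  ext h
  have hterm : ∀ i : Fin (k + 1),
      iteratedFDeriv ℝ (k + 1) g x (Function.update (fun _ => y - x) i h) =
        iteratedFDeriv ℝ k (fderiv ℝ g) x (fun _ => y - x) h := by
    intro i
    rw [iteratedFDeriv_update_const_eq hg x (y - x) h i (Fin.last k),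
      iteratedFDeriv_succ_apply_right, Fin.init_update_last, Function.update_self]
    rfl
  have hk : ((k : ℝ) + 1) ≠ 0 := by positivity
  have hk' : (Nat.factorial k : ℝ) ≠ 0 := by positivity
  simp only [smul_apply, sum_apply,
    ContinuousLinearMap.comp_apply, ContinuousLinearMap.id_apply,
    ContinuousMultilinearMap.toContinuousLinearMap_apply, hterm, Finset.sum_const,
    Finset.card_univ, Fintype.card_fin]
  rw [← Nat.cast_smul_eq_nsmul ℝ, smul_smul, Nat.factorial_succ]
  congr 1
  push_cast
  field_simp

/-- Taylor expansion commutes with differentiation. -/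
theorem hasFDerivAt_taylorSum {m : ℕ} {g : E → F} (hg : ContDiff ℝ (m + 1 : ℕ) g) (x y : E) :
    HasFDerivAt (taylorSum (m + 1) g x) (taylorSum m (fderiv ℝ g) x y) y := by
  have h : HasFDerivAt (fun z => (∑ k ∈ Finset.range (m + 1),
      (1 / (Nat.factorial (k + 1) : ℝ)) • iteratedFDeriv ℝ (k + 1) g x (fun _ => z - x)) + g x)
      (taylorSum m (fderiv ℝ g) x y) y := by
    refine HasFDerivAt.add_const _ (HasFDerivAt.fun_sum fun k hk => ?_)
    have hk' : k + 1 ≤ m + 1 := by simpa using hk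
    exact hasFDerivAt_iteratedFDeriv_diag (hg.of_le (by exact_mod_cast hk')) x y
  convert h using 2 with z
  rw [taylorSum, Finset.sum_range_succ']
  simp

theorem lipschitzWith_iteratedFDeriv_fderiv {m : ℕ} {g : E → F} {L : ℝ≥0}
    (hL : LipschitzWith L (iteratedFDeriv ℝ (m + 1) g)) :
    LipschitzWith L (iteratedFDeriv ℝ m (fderiv ℝ g)) := by
  intro a b
  have h := hL a b
  rwa [iteratedFDeriv_succ_eq_comp_right, iteratedFDeriv_succ_eq_comp_right,
    Function.comp_apply, Function.comp_apply, LinearIsometryEquiv.edist_map] at h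

/-- Taylor's theorem with a Lipschitz top derivative. By `hasFDerivAt_taylorSum` the remainder of `g`
has as derivative the remainder of `fderiv ℝ g`, so the bound follows by induction on `m` and the
mean value inequality along the segment from `x` to `y`. -/
theorem norm_sub_taylorSum_le {m : ℕ} {g : E → F} {L : ℝ≥0} (hg : ContDiff ℝ m g)
    (hL : LipschitzWith L (iteratedFDeriv ℝ m g)) (x y : E) :
    ‖g y - taylorSum m g x y‖ ≤ L / (Nat.factorial (m + 1) : ℝ) * ‖y - x‖ ^ (m + 1) := by
  induction m generalizing F y with
  | zero =>
    have h := hL.norm_sub_le y x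
    rw [iteratedFDeriv_zero_eq_comp, Function.comp_apply, Function.comp_apply,
      ← map_sub, LinearIsometryEquiv.norm_map] at h
    simpa [taylorSum] using h
  | succ m ih =>
    have hg' : ContDiff ℝ m (fderiv ℝ g) := hg.fderiv_right (by norm_cast)
    have hgd : Differentiable ℝ g := hg.differentiable (by simp)
    set d := y - x with hd
    have hline : ∀ t : ℝ, HasDerivAt (fun t : ℝ => x + t • d) d t := fun t => by
      simpa using ((hasDerivAt_id t).smul_const d).const_add x
    have hder : ∀ t : ℝ, HasDerivAt
        (fun t : ℝ => g (x + t • d) - taylorSum (m + 1) g x (x + t • d))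
        ((fderiv ℝ g (x + t • d) - taylorSum m (fderiv ℝ g) x (x + t • d)) d) t := fun t =>
      (((hgd _).hasFDerivAt.sub (hasFDerivAt_taylorSum hg x _)).comp_hasDerivAt t (hline t))
    have hB : ∀ t : ℝ, HasDerivAt
        (fun t : ℝ => L / (Nat.factorial (m + 2) : ℝ) * ‖d‖ ^ (m + 2) * t ^ (m + 2))
        (L / (Nat.factorial (m + 1) : ℝ) * ‖d‖ ^ (m + 2) * t ^ (m + 1)) t := fun t => by
      refine ((hasDerivAt_pow (m + 2) t).const_mul _).congr_deriv ?_
      rw [Nat.factorial_succ (m + 1)]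
      have : (Nat.factorial (m + 1) : ℝ) ≠ 0 := by positivity
      rw [show m + 2 - 1 = m + 1 from rfl]
      push_cast
      field_simp
      ring
    have hbound := image_norm_le_of_norm_deriv_right_le_deriv_boundary (a := 0) (b := 1)
      (fun t _ => (hder t).continuousAt.continuousWithinAt)
      (fun t _ => (hder t).hasDerivWithinAt) ?_ hB ?_ (Set.right_mem_Icc.2 zero_le_one)
    · simpa [hd] using hbound
    · simp [taylorSum_self]
    · rintro t ⟨ht, -⟩
      refine (ContinuousLinearMap.le_opNorm _ _).trans ?_
      have h := ih hg' (lipschitzWith_iteratedFDeriv_fderiv hL) (x + t • d)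
      rw [add_sub_cancel_left, norm_smul, Real.norm_of_nonneg ht] at h
      calc _ ≤ L / (Nat.factorial (m + 1) : ℝ) * (t * ‖d‖) ^ (m + 1) * ‖d‖ := by gcongr
        _ = _ := by ring

end Taylor

/-! ### The regularized Taylor model -/

theorem hasGradientAt_norm_sub_pow {E : Type*} [NormedAddCommGroup E] [InnerProductSpace ℝ E]
    [CompleteSpace E] (q : ℕ) (x y : E) :
    HasGradientAt (fun z => ‖z - x‖ ^ (q + 2)) ((((q : ℝ) + 2) * ‖y - x‖ ^ q) • (y - x)) y := by
  have h := (hasFDerivAt_norm_rpow (y - x) (p := (q : ℝ) + 2)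
    (by linarith [q.cast_nonneg (α := ℝ)])).comp y ((hasFDerivAt_id y).sub_const x)
  rw [hasGradientAt_iff_hasFDerivAt]
  convert! h using 1
  · funext z
    rw [Function.comp_apply, ← Real.rpow_natCast]
    norm_num
  · ext v
    simp [add_sub_cancel_right, Real.rpow_natCast]

theorem hasGradientAt_regularizedModel {n q : ℕ} (H : ℝ) {f : EuclideanSpace ℝ (Fin n) → ℝ}
    (hf : ContDiff ℝ (q + 1 : ℕ) f) (x T : EuclideanSpace ℝ (Fin n)) :
    HasGradientAt (fun y => regularizedModel (q + 1) H f x y)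
      ((InnerProductSpace.toDual ℝ _).symm (taylorSum q (fderiv ℝ f) x T) +
        (H * ((q : ℝ) + 2) / (Nat.factorial (q + 1) : ℝ) * ‖T - x‖ ^ q) • (T - x)) T := by
  have h1 := hasFDerivAt_taylorSum hf x T
  have h2 := (hasGradientAt_norm_sub_pow q x T).hasFDerivAt.const_mul
    (H / (Nat.factorial (q + 1) : ℝ))
  rw [hasGradientAt_iff_hasFDerivAt]
  refine ((h1.add h2).congr_fderiv ?_)
  rw [map_add, LinearIsometryEquiv.apply_symm_apply, map_smul, map_smul, smul_smul]
  congr 2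
  ring

/-- At an inexact solution `T` of the subproblem, `∇f(T)` almost cancels the gradient of the
regularizer: the error consists of the inexactness and the Taylor remainder of `∇f`. -/
theorem norm_gradient_add_smul_le {n q : ℕ} {H γ : ℝ} {f : EuclideanSpace ℝ (Fin n) → ℝ}
    {L : ℝ≥0} (hf : ContDiff ℝ (q + 1 : ℕ) f) (hL : LipschitzWith L (iteratedFDeriv ℝ (q + 1) f))
    {x T : EuclideanSpace ℝ (Fin n)} (hT : T ∈ inexactSolutions (q + 1) H γ f x) :
    ‖gradient f T + (H * ((q : ℝ) + 2) / (Nat.factorial (q + 1) : ℝ) * ‖T - x‖ ^ q) • (T - x)‖ ≤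
      γ * ‖gradient f T‖ + L / (Nat.factorial (q + 1) : ℝ) * ‖T - x‖ ^ (q + 1) := by
  have hg : ContDiff ℝ q (fderiv ℝ f) := hf.fderiv_right (by norm_cast)
  have hTaylor := norm_sub_taylorSum_le hg (lipschitzWith_iteratedFDeriv_fderiv hL) x T
  have hmodel : ‖gradient (fun y => regularizedModel (q + 1) H f x y) T‖ ≤ γ * ‖gradient f T‖ :=
    hT
  rw [(hasGradientAt_regularizedModel H hf x T).gradient] at hmodel
  rw [← LinearIsometryEquiv.norm_map (InnerProductSpace.toDual ℝ _).symm, map_sub] at hTaylor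
  refine le_trans ?_ (add_le_add hmodel hTaylor)
  refine le_trans (le_of_eq ?_) (norm_add_le _ _)
  rw [gradient]
  congr 1
  abel

/-- If `v` is close to `-c d`, relative to the sizes of `v` and `c d`, and `l c ∈ [1/2, 1]`, then
`l v` is close to `-d`: the relative error is a constant, smaller than `1` when `2γ + β < 1`. -/
theorem norm_smul_add_le_of_norm_add_smul_le {E : Type*} [NormedAddCommGroup E] [NormedSpace ℝ E]
    {v d : E} {c l γ β : ℝ} (hl : 0 < l) (hγ : 0 ≤ γ) (hβ : 0 ≤ β) (hpar : 2 * γ + β < 1)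
    (h : ‖v + c • d‖ ≤ γ * ‖v‖ + β * c * ‖d‖) (hlow : 1 / 2 ≤ l * c) (hup : l * c ≤ 1) :
    ‖l • v + d‖ ≤ (1 + (γ + β) / (1 - γ)) / 2 * ‖d‖ := by
  set s := l * c with hs
  have hγ1 : 0 < 1 - γ := by linarith
  have hd := norm_nonneg d
  have hscaled : ‖l • v + s • d‖ ≤ γ * ‖l • v‖ + β * s * ‖d‖ := by
    have e : l • v + s • d = l • (v + c • d) := by rw [smul_add, smul_smul]
    rw [e, norm_smul, norm_smul, Real.norm_of_nonneg hl.le]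
    calc l * ‖v + c • d‖ ≤ l * (γ * ‖v‖ + β * c * ‖d‖) := by gcongr
      _ = _ := by rw [hs]; ring
  have hv : (1 - γ) * ‖l • v‖ ≤ s * (1 + β) * ‖d‖ := by
    have h1 : ‖l • v‖ ≤ ‖l • v + s • d‖ + ‖s • d‖ := by
      simpa using norm_sub_le (l • v + s • d) (s • d)
    rw [norm_smul s d, Real.norm_of_nonneg (by linarith)] at h1
    linarith
  -- The bound on `‖l • v‖` turns the implicit error estimate into one relative to `‖d‖` alone.
  have hres : ‖l • v + s • d‖ ≤ s * ((γ + β) / (1 - γ)) * ‖d‖ := by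
    have hv' : ‖l • v‖ ≤ s * (1 + β) * ‖d‖ / (1 - γ) := by
      rw [le_div_iff₀ hγ1]; linarith
    calc _ ≤ γ * (s * (1 + β) * ‖d‖ / (1 - γ)) + β * s * ‖d‖ := by
          refine hscaled.trans ?_; gcongr
      _ = _ := by field_simp; ring
  have hq : (γ + β) / (1 - γ) < 1 := by rw [div_lt_one hγ1]; linarith
  have hsplit : ‖l • v + d‖ ≤ ‖l • v + s • d‖ + (1 - s) * ‖d‖ := by
    have e : l • v + d = (l • v + s • d) + (1 - s) • d := by rw [sub_smul, one_smul]; abel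
    rw [e]
    refine (norm_add_le _ _).trans ?_
    rw [norm_smul, Real.norm_of_nonneg (by linarith : 0 ≤ 1 - s)]
  have hfin : s * ((γ + β) / (1 - γ)) + (1 - s) ≤ (1 + (γ + β) / (1 - γ)) / 2 := by
    nlinarith
  nlinarith

/-! ### The potential of an accelerated inexact proximal step -/

theorem ConvexOn.add_inner_gradient_le {E : Type*} [NormedAddCommGroup E] [InnerProductSpace ℝ E]
    [CompleteSpace E] {f : E → ℝ} (hf : ConvexOn ℝ Set.univ f) {y : E}
    (hd : DifferentiableAt ℝ f y) (z : E) :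
    f y + inner ℝ (gradient f y) (z - y) ≤ f z := by
  have hline : HasDerivAt (fun t : ℝ => AffineMap.lineMap y z t) (z - y) 0 :=
    AffineMap.hasDerivAt_lineMap
  have hd0 : HasFDerivAt f (fderiv ℝ f y) (AffineMap.lineMap y z (0 : ℝ)) := by
    simpa using hd.hasFDerivAt
  have h := (hf.comp_affineMap (AffineMap.lineMap (k := ℝ) y z)).le_slope_of_hasDerivAt
    (Set.mem_univ (0 : ℝ)) (Set.mem_univ 1) one_pos (hd0.comp_hasDerivAt 0 hline)
  have hgrad : inner ℝ (gradient f y) (z - y) = fderiv ℝ f y (z - y) := by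
    rw [gradient, InnerProductSpace.toDual_symm_apply]
  rw [hgrad]
  simp only [slope_def_field, Function.comp_apply, AffineMap.lineMap_apply_one,
    AffineMap.lineMap_apply_zero, sub_zero, div_one] at h
  linarith

/-- The weight `a` is the positive root of `a² = l (A + a)`; it makes `√A` grow by at least
`√l / 2`. -/
theorem step_weight_props {A l a : ℝ} (hA : 0 ≤ A) (hl : 0 < l)
    (ha : a = (l + Real.sqrt (l ^ 2 + 4 * l * A)) / 2) :
    0 < a ∧ a ^ 2 = l * (A + a) ∧ Real.sqrt A + Real.sqrt l / 2 ≤ Real.sqrt (A + a) := by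
  have hlA : 0 ≤ l * A := by positivity
  have hdisc : 0 ≤ l ^ 2 + 4 * l * A := by positivity
  have hsq := Real.sq_sqrt hdisc
  refine ⟨?_, ?_, ?_⟩
  · rw [ha]; positivity
  · rw [ha]; nlinarith
  · apply Real.le_sqrt_of_sq_le
    have h1 : 2 * (Real.sqrt l * Real.sqrt A) ≤ Real.sqrt (l ^ 2 + 4 * l * A) := by
      apply Real.le_sqrt_of_sq_le
      rw [mul_pow, mul_pow, Real.sq_sqrt hl.le, Real.sq_sqrt hA]
      nlinarith [sq_nonneg l]
    nlinarith [Real.sq_sqrt hl.le, Real.sq_sqrt hA]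

/-- One accelerated proximal step with relative error `τ` decreases the potential
`A (f(y) - f(x⋆)) + ‖x - x⋆‖² / 2` by at least `(1 - τ²) / 2 · A' / l · ‖y' - x̃‖²`. The vector `g`
is a subgradient at `y'`, used through its inequalities at `y` and at `xs` only. -/
theorem potential_step_le {E : Type*} [NormedAddCommGroup E] [InnerProductSpace ℝ E]
    {x y x' y' xt xs g : E} {A A' a l τ φ φ' φs : ℝ} (hA : 0 ≤ A) (hl : 0 < l) (ha : 0 < a)
    (hA' : A' = A + a) (hal : a ^ 2 = l * A')
    (hxt : xt = (A / A') • y + (a / A') • x) (hx' : x' = x - a • g)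
    (herr : ‖l • g + (y' - xt)‖ ≤ τ * ‖y' - xt‖)
    (hy : φ' + inner ℝ g (y - y') ≤ φ) (hs : φ' + inner ℝ g (xs - y') ≤ φs) :
    A' * (φ' - φs) + ‖x' - xs‖ ^ 2 / 2 + (1 - τ ^ 2) / 2 * (A' / l * ‖y' - xt‖ ^ 2) ≤
      A * (φ - φs) + ‖x - xs‖ ^ 2 / 2 := by
  have hA'pos : 0 < A' := by linarith
  set d := y' - xt with hd
  have hgd : A' * inner ℝ g d = A' * inner ℝ g y' - A * inner ℝ g y - a * inner ℝ g x := by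
    rw [hd, hxt, inner_sub_right, inner_add_right, inner_smul_right, inner_smul_right]
    field_simp
    ring
  have hx'n : ‖x' - xs‖ ^ 2 =
      ‖x - xs‖ ^ 2 - 2 * a * (inner ℝ g x - inner ℝ g xs) + a ^ 2 * ‖g‖ ^ 2 := by
    have e : x' - xs = (x - xs) - a • g := by rw [hx']; abel
    rw [e, norm_sub_sq_real, inner_smul_right, norm_smul, mul_pow, Real.norm_eq_abs, sq_abs,
      real_inner_comm, inner_sub_right]
    ring
  -- Squared, the error bound controls `2 ⟪l g, y' - x̃⟫ + ‖l g‖²`, the quantity by which the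
  -- potential changes after multiplication by `A' / (2 l)`.
  have herr2 : l ^ 2 * ‖g‖ ^ 2 + 2 * l * inner ℝ g d + ‖d‖ ^ 2 ≤ τ ^ 2 * ‖d‖ ^ 2 := by
    have h := pow_le_pow_left₀ (norm_nonneg _) herr 2
    rw [norm_add_sq_real, real_inner_smul_left, norm_smul, mul_pow, mul_pow, Real.norm_eq_abs,
      sq_abs] at h
    linarith
  set w := A' / l with hw
  have hwl : A' = w * l := by rw [hw]; field_simp
  have hwpos : 0 < w := by positivity
  have hmul := mul_le_mul_of_nonneg_left herr2 hwpos.le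
  have e1 : w * (l ^ 2 * ‖g‖ ^ 2 + 2 * l * inner ℝ g d + ‖d‖ ^ 2) =
      a ^ 2 * ‖g‖ ^ 2 + 2 * (A' * inner ℝ g d) + w * ‖d‖ ^ 2 := by
    rw [hal, hwl]; ring
  rw [e1, hgd] at hmul
  rw [inner_sub_right] at hy hs
  have hy' := mul_le_mul_of_nonneg_left hy hA
  have hs' := mul_le_mul_of_nonneg_left hs ha.le
  rw [hx'n]
  rw [hA'] at hmul ⊢
  linarith

/-! ### Growth of the weights -/

/-- Hölder's inequality for finite sums with weights `s + t = 1`; unlike the version with conjugate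
exponents it allows `s = 0`, which occurs for first-order methods. -/
theorem sum_rpow_mul_rpow_le {ι : Type*} (S : Finset ι) {u v : ι → ℝ} {s t U V : ℝ}
    (hs : 0 ≤ s) (ht : 0 ≤ t) (hst : s + t = 1) (hu : ∀ i ∈ S, 0 ≤ u i) (hv : ∀ i ∈ S, 0 ≤ v i)
    (hU : 0 < U) (hV : 0 < V) (hsu : ∑ i ∈ S, u i ≤ U) (hsv : ∑ i ∈ S, v i ≤ V) :
    ∑ i ∈ S, u i ^ s * v i ^ t ≤ U ^ s * V ^ t := by
  have hterm : ∀ i ∈ S, u i ^ s * v i ^ t ≤ U ^ s * V ^ t * (s * (u i / U) + t * (v i / V)) := by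
    intro i hi
    have hu' := hu i hi
    have hv' := hv i hi
    have h := Real.geom_mean_le_arith_mean2_weighted hs ht (div_nonneg hu' hU.le)
      (div_nonneg hv' hV.le) hst
    rw [Real.div_rpow hu' hU.le, Real.div_rpow hv' hV.le, div_mul_div_comm,
      div_le_iff₀ (by positivity)] at h
    linarith
  calc ∑ i ∈ S, u i ^ s * v i ^ t
      ≤ ∑ i ∈ S, U ^ s * V ^ t * (s * (u i / U) + t * (v i / V)) := Finset.sum_le_sum hterm
    _ = U ^ s * V ^ t * (s * ((∑ i ∈ S, u i) / U) + t * ((∑ i ∈ S, v i) / V)) := by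
        rw [← Finset.mul_sum, Finset.sum_add_distrib, ← Finset.mul_sum, ← Finset.mul_sum,
          Finset.sum_div, Finset.sum_div]
    _ ≤ U ^ s * V ^ t * (s * 1 + t * 1) := by
        have h1 : (∑ i ∈ S, u i) / U ≤ 1 := (div_le_one hU).2 hsu
        have h2 : (∑ i ∈ S, v i) / V ≤ 1 := (div_le_one hV).2 hsv
        gcongr
    _ = U ^ s * V ^ t := by rw [mul_one, mul_one, hst, mul_one]

/-- A discrete differential inequality: if the increments of `B` dominate `(c B)^(1 - δ)` at the new
value of `B`, then `B^δ` grows linearly. -/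
theorem mul_natCast_le_rpow_of_increment {B : ℕ → ℝ} {c δ : ℝ} {K : ℕ} (hδ : 0 < δ)
    (hδ1 : δ ≤ 1) (hc : 0 < c) (hB0 : B 0 = 0) (hB : ∀ k < K, 0 ≤ B k)
    (hBpos : ∀ k < K, 0 < B (k + 1))
    (hinc : ∀ k < K, (c * B (k + 1)) ^ (1 - δ) ≤ B (k + 1) - B k) :
    ∀ k ≤ K, δ * c ^ (1 - δ) * k ≤ B k ^ δ := by
  intro k
  induction k with
  | zero => intro _; simp [hB0, Real.zero_rpow hδ.ne']
  | succ k ih =>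
    intro hk
    have hk' : k < K := hk
    have h0 := hB k hk'
    have h1 := hBpos k hk'
    have hinc' := hinc k hk'
    rw [Real.mul_rpow hc.le h1.le] at hinc'
    -- Concavity of `t ↦ t ^ δ`, as Bernoulli's inequality at the ratio `B k / B (k + 1)`.
    have hbern := rpow_one_add_le_one_add_mul_self (s := B k / B (k + 1) - 1) (p := δ)
      (by linarith [div_nonneg h0 h1.le]) hδ.le hδ1
    rw [add_sub_cancel, Real.div_rpow h0 h1.le, div_le_iff₀ (by positivity)] at hbern
    have hpow : B (k + 1) ^ (1 - δ) * B (k + 1) ^ δ = B (k + 1) := by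
      rw [← Real.rpow_add h1, sub_add_cancel, Real.rpow_one]
    have hgain : c ^ (1 - δ) ≤ (1 - B k / B (k + 1)) * B (k + 1) ^ δ := by
      have e : (1 - B k / B (k + 1)) * B (k + 1) ^ δ =
          (B (k + 1) - B k) * (B (k + 1) ^ δ / B (k + 1)) := by field_simp
      rw [e]
      calc c ^ (1 - δ)
          = c ^ (1 - δ) * B (k + 1) ^ (1 - δ) * (B (k + 1) ^ δ / B (k + 1)) := by
            rw [mul_assoc, ← mul_div_assoc, hpow, div_self h1.ne', mul_one]
        _ ≤ _ := by gcongr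
    have := ih hk'.le
    have := mul_le_mul_of_nonneg_left hgain hδ.le
    push_cast
    linarith

/-- The growth `A_k ≥ const · k^((3p + 1) / 2)` of the weights, from the budget
`∑ A_{i+1} / l_{i+1} · r_i² ≤ D`, the growth of `√A` and the lower bound `κ ≤ l_{i+1} r_i^(p - 1)`.
Hölder's inequality gives `c B_k ≤ A_k^(t / 2)` for `B_k = ∑_{i<k} A_{i+1}^s`, which is a difference
inequality for `B` because `A_{k+1}^s` is an increment of `B`. -/
theorem weight_growth {p K : ℕ} (hp : 1 ≤ p) {A l r : ℕ → ℝ} {κ D : ℝ} (hκ : 0 < κ) (hD : 0 < D)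
    (hA0 : A 0 = 0) (hA : ∀ i < K, 0 < A (i + 1)) (hl : ∀ i < K, 0 < l (i + 1))
    (hr : ∀ i < K, 0 ≤ r i) (hlr : ∀ i < K, κ ≤ l (i + 1) * r i ^ (p - 1))
    (hsqrt : ∀ i < K, Real.sqrt (A i) + Real.sqrt (l (i + 1)) / 2 ≤ Real.sqrt (A (i + 1)))
    (hsum : ∀ k ≤ K, ∑ i ∈ Finset.range k, A (i + 1) / l (i + 1) * r i ^ 2 ≤ D)
    {k : ℕ} (hkK : k ≤ K) :
    (2 / ((p : ℝ) + 1)) ^ ((3 * (p : ℝ) + 1) / 2) * (κ * (D ^ (((p : ℝ) - 1) / 2))⁻¹ *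
      ((2 : ℝ) ^ ((p : ℝ) + 1))⁻¹) * (k : ℝ) ^ ((3 * (p : ℝ) + 1) / 2) ≤ A k := by
  have hp1 : (1 : ℝ) ≤ p := by exact_mod_cast hp
  have hpne : (p : ℝ) + 1 ≠ 0 := by positivity
  have hp3 : 3 * (p : ℝ) + 1 ≠ 0 := by positivity
  -- The Hölder weights `s`, `t` and the exponent `u` of `κ` are determined by the requirement that
  -- `(A / l · r²)^s (√l)^t = A^s (l r^(p - 1))^u`.
  obtain ⟨s, hs⟩ : ∃ s : ℝ, s = ((p : ℝ) - 1) / (3 * p + 1) := ⟨_, rfl⟩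
  obtain ⟨t, ht⟩ : ∃ t : ℝ, t = (2 * (p : ℝ) + 2) / (3 * p + 1) := ⟨_, rfl⟩
  obtain ⟨u, hu⟩ : ∃ u : ℝ, u = 2 / (3 * (p : ℝ) + 1) := ⟨_, rfl⟩
  obtain ⟨δ, hδ⟩ : ∃ δ : ℝ, δ = 2 / ((p : ℝ) + 1) := ⟨_, rfl⟩
  obtain ⟨m, hm⟩ : ∃ m : ℝ, m = (3 * (p : ℝ) + 1) / 2 := ⟨_, rfl⟩
  have hs0 : 0 ≤ s := by rw [hs]; exact div_nonneg (by linarith) (by positivity)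
  have ht0 : 0 < t := by rw [ht]; positivity
  have hu0 : 0 < u := by rw [hu]; positivity
  have hδ0 : 0 < δ := by rw [hδ]; positivity
  have hm0 : 0 < m := by rw [hm]; positivity
  have hδ1 : δ ≤ 1 := by rw [hδ, div_le_one (by positivity)]; linarith
  have hst : s + t = 1 := by rw [hs, ht]; field_simp; ring
  have hus : u + s = t / 2 := by rw [hs, ht, hu]; field_simp; ring
  have hps : ((p : ℝ) - 1) * u = 2 * s := by rw [hs, hu]; ring
  have htδ : t / 2 * (1 - δ) = s := by rw [hs, ht, hδ]; field_simp; ring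
  have htδm : t / 2 * δ * m = 1 := by rw [ht, hδ, hm]; field_simp
  have hum : u * m = 1 := by rw [hu, hm]; field_simp
  have hsm : s * m = ((p : ℝ) - 1) / 2 := by rw [hs, hm]; field_simp
  have htm : t * m = (p : ℝ) + 1 := by rw [ht, hm]; field_simp
  have hAnn : ∀ i ≤ K, 0 ≤ A i := by
    intro i hi
    cases i with
    | zero => exact hA0.ge
    | succ i => exact (hA i hi).le
  have hsqrtsum : ∀ k ≤ K,
      ∑ i ∈ Finset.range k, Real.sqrt (l (i + 1)) ≤ 2 * Real.sqrt (A k) := by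
    intro k
    induction k with
    | zero => intro _; simp
    | succ k ih =>
      intro hk
      rw [Finset.sum_range_succ]
      linarith [ih (Nat.le_of_succ_le hk), hsqrt k hk]
  have hterm : ∀ i < K, κ ^ u * A (i + 1) ^ s ≤
      (A (i + 1) / l (i + 1) * r i ^ 2) ^ s * Real.sqrt (l (i + 1)) ^ t := by
    intro i hi
    have hAi := hA i hi
    have hli := hl i hi
    have hri := hr i hi
    have e1 : (l (i + 1) * r i ^ (p - 1)) ^ u = l (i + 1) ^ u * r i ^ (2 * s) := by
      rw [Real.mul_rpow hli.le (by positivity), ← Real.rpow_natCast (r i), ← Real.rpow_mul hri,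
        Nat.cast_sub hp, Nat.cast_one, hps]
    have e2 : (A (i + 1) / l (i + 1) * r i ^ 2) ^ s * Real.sqrt (l (i + 1)) ^ t =
        A (i + 1) ^ s * (l (i + 1) ^ u * r i ^ (2 * s)) := by
      rw [Real.mul_rpow (by positivity) (by positivity), Real.div_rpow hAi.le hli.le,
        Real.sqrt_eq_rpow, ← Real.rpow_natCast (r i), ← Real.rpow_mul hri, ← Real.rpow_mul hli.le,
        show 1 / 2 * t = u + s by rw [hus]; ring, Real.rpow_add hli]
      have : l (i + 1) ^ s ≠ 0 := by positivity
      push_cast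
      field_simp
    rw [e2, ← e1, mul_comm]
    have := hlr i hi
    gcongr
  set B : ℕ → ℝ := fun k => ∑ i ∈ Finset.range k, A (i + 1) ^ s with hB
  have hBnn : ∀ k ≤ K, 0 ≤ B k := fun k hk => Finset.sum_nonneg fun i hi =>
    Real.rpow_nonneg (hA i ((Finset.mem_range.1 hi).trans_le hk)).le _
  have hBsucc : ∀ k, B (k + 1) = B k + A (k + 1) ^ s := fun k => Finset.sum_range_succ _ _
  set c := κ ^ u * (D ^ s)⁻¹ * ((2 : ℝ) ^ t)⁻¹ with hc
  have hcpos : 0 < c := by positivity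
  have hcB : ∀ k < K, c * B (k + 1) ≤ A (k + 1) ^ (t / 2) := by
    intro k hk
    have hAk := hA k hk
    have hlt : ∀ i ∈ Finset.range (k + 1), i < K := fun i hi =>
      lt_of_lt_of_le (Finset.mem_range.1 hi) hk
    have h := sum_rpow_mul_rpow_le (Finset.range (k + 1))
      (u := fun i => A (i + 1) / l (i + 1) * r i ^ 2) (v := fun i => Real.sqrt (l (i + 1)))
      (V := 2 * Real.sqrt (A (k + 1))) hs0 ht0.le hst
      (fun i hi => by have := hA i (hlt i hi); have := hl i (hlt i hi); positivity)
      (fun i _ => Real.sqrt_nonneg _) hD (by positivity) (hsum (k + 1) hk) (hsqrtsum (k + 1) hk)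
    have h' : κ ^ u * B (k + 1) ≤ D ^ s * ((2 : ℝ) ^ t * A (k + 1) ^ (t / 2)) := by
      have e : (2 * Real.sqrt (A (k + 1))) ^ t = (2 : ℝ) ^ t * A (k + 1) ^ (t / 2) := by
        rw [Real.mul_rpow (by norm_num) (Real.sqrt_nonneg _), Real.sqrt_eq_rpow,
          ← Real.rpow_mul hAk.le, one_div_mul_eq_div]
      rw [← e]
      refine le_trans ?_ h
      rw [hB, Finset.mul_sum]
      exact Finset.sum_le_sum fun i hi => hterm i (hlt i hi)
    calc c * B (k + 1) = (D ^ s)⁻¹ * ((2 : ℝ) ^ t)⁻¹ * (κ ^ u * B (k + 1)) := by rw [hc]; ring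
      _ ≤ (D ^ s)⁻¹ * ((2 : ℝ) ^ t)⁻¹ * (D ^ s * ((2 : ℝ) ^ t * A (k + 1) ^ (t / 2))) := by
          gcongr
      _ = A (k + 1) ^ (t / 2) := by field_simp
  have hgrow := mul_natCast_le_rpow_of_increment (B := B) (K := K) hδ0 hδ1 hcpos (by simp [hB])
    (fun k hk => hBnn k hk.le)
    (fun k hk => by
      rw [hBsucc]; exact add_pos_of_nonneg_of_pos (hBnn k hk.le) (Real.rpow_pos_of_pos (hA k hk) _))
    (fun k hk => by
      rw [hBsucc, add_sub_cancel_left, ← hBsucc]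
      calc (c * B (k + 1)) ^ (1 - δ) ≤ (A (k + 1) ^ (t / 2)) ^ (1 - δ) :=
            Real.rpow_le_rpow (mul_nonneg hcpos.le (hBnn _ hk)) (hcB k hk) (by linarith)
        _ = A (k + 1) ^ s := by rw [← Real.rpow_mul (hA k hk).le, htδ]) k hkK
  have hroot : δ * c * k ≤ A k ^ (t / 2 * δ) := by
    have hcBk : c * B k ≤ A k ^ (t / 2) := by
      cases k with
      | zero => simp [hB]; exact Real.rpow_nonneg hA0.ge _
      | succ k => exact hcB k hkK
    calc δ * c * k = c ^ δ * (δ * c ^ (1 - δ) * k) := by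
          have : c ^ δ * c ^ (1 - δ) = c := by
            rw [← Real.rpow_add hcpos, add_sub_cancel, Real.rpow_one]
          linear_combination -(δ * k) * this
      _ ≤ c ^ δ * B k ^ δ := by gcongr
      _ = (c * B k) ^ δ := (Real.mul_rpow hcpos.le (hBnn k hkK)).symm
      _ ≤ (A k ^ (t / 2)) ^ δ :=
          Real.rpow_le_rpow (mul_nonneg hcpos.le (hBnn k hkK)) hcBk hδ0.le
      _ = A k ^ (t / 2 * δ) := (Real.rpow_mul (hAnn k hkK) _ _).symm
  have hfin : (δ * c * k) ^ m ≤ A k := by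
    calc (δ * c * k) ^ m ≤ (A k ^ (t / 2 * δ)) ^ m := by gcongr
      _ = A k := by rw [← Real.rpow_mul (hAnn k hkK), htδm, Real.rpow_one]
  have hcm : c ^ m = κ * (D ^ (((p : ℝ) - 1) / 2))⁻¹ * ((2 : ℝ) ^ ((p : ℝ) + 1))⁻¹ := by
    rw [hc, Real.mul_rpow (by positivity) (by positivity),
      Real.mul_rpow (by positivity) (by positivity), Real.inv_rpow (by positivity),
      Real.inv_rpow (by positivity), ← Real.rpow_mul hκ.le, ← Real.rpow_mul hD.le,
      ← Real.rpow_mul (by norm_num), hum, hsm, htm, Real.rpow_one]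
  rw [← hcm, ← hδ, ← hm, ← Real.mul_rpow hδ0.le hcpos.le,
    ← Real.mul_rpow (by positivity) (Nat.cast_nonneg k)]
  exact hfin

/-! ### Runs of the method -/

namespace IsNATMIRun

variable {n p K : ℕ} {H γ : ℝ} {f : EuclideanSpace ℝ (Fin n) → ℝ} {A a lam : ℕ → ℝ}
  {x y xt : ℕ → EuclideanSpace ℝ (Fin n)}

theorem A_nonneg (h : IsNATMIRun p H γ f K A a lam x y xt) : ∀ k ≤ K, 0 ≤ A k := by
  intro k
  induction k with
  | zero => intro _; exact h.A_zero.ge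
  | succ k ih =>
    intro hk
    rw [h.A_succ k hk]
    have hA := ih (Nat.le_of_succ_le hk)
    exact add_nonneg hA (step_weight_props hA (h.lam_pos k hk) (h.a_succ k hk)).1.le

theorem A_succ_pos (h : IsNATMIRun p H γ f K A a lam x y xt) {k : ℕ} (hk : k < K) :
    0 < A (k + 1) := by
  have hA := h.A_nonneg k hk.le
  rw [h.A_succ k hk]
  exact add_pos_of_nonneg_of_pos hA (step_weight_props hA (h.lam_pos k hk) (h.a_succ k hk)).1

/-- Each step is an approximate proximal step of size `lam (k + 1)` from `xt k`, with a relative error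
that is smaller than `1` when `2γ + 1 / (ξ (p + 1)) < 1`. -/
theorem residual_le {ξ : ℝ} {L : ℝ≥0} (h : IsNATMIRun p (ξ * L) γ f K A a lam x y xt)
    (hp : 1 ≤ p) (hξ : 0 < ξ) (hγ : 0 ≤ γ) (hpar : 2 * γ + 1 / (ξ * ((p : ℝ) + 1)) < 1)
    (hf : ContDiff ℝ p f) (hL : LipschitzWith L (iteratedFDeriv ℝ p f)) {k : ℕ} (hk : k < K) :
    ‖lam (k + 1) • gradient f (y (k + 1)) + (y (k + 1) - xt k)‖ ≤
      (1 + (γ + 1 / (ξ * ((p : ℝ) + 1))) / (1 - γ)) / 2 * ‖y (k + 1) - xt k‖ := by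
  obtain ⟨q, rfl⟩ := Nat.exists_eq_add_of_le' hp
  have hlow := h.step_lower k hk
  have hup := h.step_upper k hk
  have hgrad := norm_gradient_add_smul_le hf hL (h.y_mem k hk)
  rw [Nat.add_sub_cancel] at hlow hup
  have hfac : (Nat.factorial q : ℝ) ≠ 0 := by positivity
  -- The gradient of the regularizer is `(p + 1) / p` times what the line-search condition measures,
  -- so that condition puts the product of `lam (k + 1)` and its coefficient into `[1/2, 1]`.
  have hstep : lam (k + 1) * (ξ * L * ((q : ℝ) + 2) / (Nat.factorial (q + 1) : ℝ) *
        ‖y (k + 1) - xt k‖ ^ q) =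
      lam (k + 1) * (ξ * L * ‖y (k + 1) - xt k‖ ^ q / (Nat.factorial q : ℝ)) *
        (((q : ℝ) + 2) / (q + 1)) := by
    rw [Nat.factorial_succ]
    push_cast
    field_simp
  have hone : 1 ≤ ((q : ℝ) + 2) / (q + 1) := by
    rw [one_le_div (by positivity)]; linarith
  refine norm_smul_add_le_of_norm_add_smul_le (h.lam_pos k hk) hγ (by positivity) hpar
    (hgrad.trans (le_of_eq ?_)) ?_ ?_
  · push_cast
    field_simp
    ring
  · rw [hstep]
    nlinarith
  · rw [hstep]
    calc _ ≤ ((q + 1 : ℕ) : ℝ) / (((q + 1 : ℕ) : ℝ) + 1) * (((q : ℝ) + 2) / (q + 1)) := by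
          gcongr
      _ = 1 := by push_cast; field_simp; ring

/-- The potential, together with the accumulated squared step lengths, never exceeds its initial
value. -/
theorem potential_le {τ : ℝ} (h : IsNATMIRun p H γ f K A a lam x y xt)
    (hconv : ConvexOn ℝ Set.univ f) (hd : Differentiable ℝ f)
    (hres : ∀ k < K, ‖lam (k + 1) • gradient f (y (k + 1)) + (y (k + 1) - xt k)‖ ≤
      τ * ‖y (k + 1) - xt k‖) (z : EuclideanSpace ℝ (Fin n)) :
    ∀ k ≤ K, A k * (f (y k) - f z) + ‖x k - z‖ ^ 2 / 2 + (1 - τ ^ 2) / 2 *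
      ∑ i ∈ Finset.range k, A (i + 1) / lam (i + 1) * ‖y (i + 1) - xt i‖ ^ 2 ≤
        ‖x 0 - z‖ ^ 2 / 2 := by
  intro k
  induction k with
  | zero => intro _; simp [h.A_zero]
  | succ k ih =>
    intro hk
    have hA := h.A_nonneg k (Nat.le_of_succ_le hk)
    obtain ⟨ha, hal, -⟩ := step_weight_props hA (h.lam_pos k hk) (h.a_succ k hk)
    rw [← h.A_succ k hk] at hal
    have hstep := potential_step_le hA (h.lam_pos k hk) ha (h.A_succ k hk) hal (h.xt_eq k hk)
      (h.x_succ k hk) (hres k hk) (hconv.add_inner_gradient_le (hd _) (y k))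
      (hconv.add_inner_gradient_le (hd _) z)
    rw [Finset.sum_range_succ, mul_add]
    linarith [ih (Nat.le_of_succ_le hk)]

end IsNATMIRun

/-! ### The convergence rate -/

theorem theorem1 (p : ℕ) (hp : 1 ≤ p) (ξ γ : ℝ) (hξ : 0 < ξ) (hγ : 0 ≤ γ)
    (hpar : 2 * γ + 1 / (ξ * ((p : ℝ) + 1)) < 1) :
    ∃ C : ℝ, 0 < C ∧
      ∀ (n : ℕ) (f : EuclideanSpace ℝ (Fin n) → ℝ) (L : ℝ≥0),
        ConvexOn ℝ Set.univ f →
        ContDiff ℝ p f →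
        LipschitzWith L (iteratedFDeriv ℝ p f) →
        ∀ xstar : EuclideanSpace ℝ (Fin n), (∀ z, f xstar ≤ f z) →
        ∀ (K : ℕ) (A a lam : ℕ → ℝ) (x y xt : ℕ → EuclideanSpace ℝ (Fin n)),
          IsNATMIRun p (ξ * (L : ℝ)) γ f K A a lam x y xt →
          ∀ k : ℕ, 1 ≤ k → k ≤ K →
            f (y k) - f xstar ≤
              C * ((ξ * (L : ℝ)) * ‖x 0 - xstar‖ ^ (p + 1) /
                (k : ℝ) ^ ((3 * (p : ℝ) + 1) / 2)) := by
  set τ : ℝ := (1 + (γ + 1 / (ξ * ((p : ℝ) + 1))) / (1 - γ)) / 2 with hτ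
  have hβ : 0 < 1 / (ξ * ((p : ℝ) + 1)) := by positivity
  have hγ1 : 0 < 1 - γ := by linarith
  have hτ0 : 0 ≤ τ := by positivity
  have hτ1 : τ < 1 := by
    have : (γ + 1 / (ξ * ((p : ℝ) + 1))) / (1 - γ) < 1 := by rw [div_lt_one hγ1]; linarith
    rw [hτ]; linarith
  obtain ⟨θ, hθ⟩ : ∃ θ : ℝ, θ = 1 - τ ^ 2 := ⟨_, rfl⟩
  have hθ0 : 0 < θ := by rw [hθ]; nlinarith
  obtain ⟨M, hM⟩ : ∃ M : ℝ, M = (2 / ((p : ℝ) + 1)) ^ ((3 * (p : ℝ) + 1) / 2) *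
      ((Nat.factorial (p - 1) : ℝ) / 2 * θ ^ (((p : ℝ) - 1) / 2) *
        ((2 : ℝ) ^ ((p : ℝ) + 1))⁻¹) := ⟨_, rfl⟩
  have hM0 : 0 < M := by rw [hM]; positivity
  refine ⟨1 / (2 * M), by positivity, ?_⟩
  intro n f L hconv hf hL xstar hmin K A a lam x y xt hrun k hk1 hkK
  obtain ⟨k, rfl⟩ := Nat.exists_eq_add_of_le' hk1
  set H : ℝ := ξ * L with hH
  set R : ℝ := ‖x 0 - xstar‖ with hR
  have hd : Differentiable ℝ f := hf.differentiable (by exact_mod_cast (by omega : p ≠ 0))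
  have hpot := hrun.potential_le hconv hd
    (fun k hk => hrun.residual_le hp hξ hγ hpar hf hL hk) xstar
  rw [← hτ, ← hθ] at hpot
  have hsum0 : ∀ k ≤ K, 0 ≤
      ∑ i ∈ Finset.range k, A (i + 1) / lam (i + 1) * ‖y (i + 1) - xt i‖ ^ 2 :=
    fun k hk => Finset.sum_nonneg fun i hi => by
      have hi' : i < K := (Finset.mem_range.1 hi).trans_le hk
      have := hrun.A_succ_pos hi'
      have := hrun.lam_pos i hi'
      positivity
  have hApos := hrun.A_succ_pos hkK
  have hvalue : A (k + 1) * (f (y (k + 1)) - f xstar) ≤ R ^ 2 / 2 := by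
    have h1 := hpot (k + 1) hkK
    have h2 := hsum0 (k + 1) hkK
    have h3 := mul_nonneg (half_pos hθ0).le h2
    linarith [sq_nonneg ‖x (k + 1) - xstar‖]
  -- The line-search condition cannot hold with `H = 0`, so a run with a step has `H > 0`.
  have hH0 : 0 < H := by
    refine lt_of_le_of_ne (by positivity) fun h0 => ?_
    have := hrun.step_lower k hkK
    rw [← h0] at this
    norm_num at this
  -- For `R = 0` the growth estimate has no positive budget, but then `hvalue` gives optimality.
  rcases (norm_nonneg (x 0 - xstar)).eq_or_lt with hR0 | hR0
  · rw [← hR] at hR0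
    rw [← hR0] at hvalue ⊢
    rw [zero_pow (Nat.succ_ne_zero p), mul_zero, zero_div, mul_zero]
    by_contra! hneg
    have := mul_pos hApos hneg
    linarith
  rw [← hR] at hR0
  have hD : 0 < R ^ 2 / θ := by positivity
  have hκ : 0 < (Nat.factorial (p - 1) : ℝ) / 2 / H := by positivity
  have hgrowth := weight_growth (r := fun i => ‖y (i + 1) - xt i‖) hp hκ hD hrun.A_zero
    (fun i hi => hrun.A_succ_pos hi) hrun.lam_pos (fun i _ => norm_nonneg _)
    (fun i hi => by
      have h := hrun.step_lower i hi
      rw [← mul_div_assoc, le_div_iff₀ (by positivity)] at h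
      rw [div_le_iff₀ hH0]
      linarith)
    (fun i hi => by
      rw [hrun.A_succ i hi]
      exact (step_weight_props (hrun.A_nonneg i hi.le) (hrun.lam_pos i hi)
        (hrun.a_succ i hi)).2.2)
    (fun j hj => by
      have h1 := hpot j hj
      have h2 : 0 ≤ A j * (f (y j) - f xstar) :=
        mul_nonneg (hrun.A_nonneg j hj) (sub_nonneg.2 (hmin _))
      rw [le_div_iff₀ hθ0]
      linarith [sq_nonneg ‖x j - xstar‖]) hkK
  have hDpow : ((R ^ 2 / θ) ^ (((p : ℝ) - 1) / 2))⁻¹ =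
      θ ^ (((p : ℝ) - 1) / 2) / R ^ (p - 1) := by
    rw [Real.div_rpow (by positivity) hθ0.le, inv_div, ← Real.rpow_natCast R 2,
      ← Real.rpow_mul hR0.le, ← Real.rpow_natCast R (p - 1), Nat.cast_sub hp]
    congr 2
    push_cast
    ring
  rw [hDpow] at hgrowth
  set N : ℝ := ((k + 1 : ℕ) : ℝ) ^ ((3 * (p : ℝ) + 1) / 2) with hN
  have hN0 : 0 < N := by positivity
  have hAlow : M * N / (H * R ^ (p - 1)) ≤ A (k + 1) := by
    refine le_trans (le_of_eq ?_) hgrowth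
    rw [hM]
    field_simp
  have hRpow : R ^ (p + 1) = R ^ 2 * R ^ (p - 1) := by
    rw [← pow_add]
    congr 1
    omega
  calc f (y (k + 1)) - f xstar ≤ R ^ 2 / 2 / A (k + 1) := by
        rw [le_div_iff₀ hApos]; linarith
    _ ≤ R ^ 2 / 2 / (M * N / (H * R ^ (p - 1))) := by gcongr
    _ = 1 / (2 * M) * (H * R ^ (p + 1) / N) := by
        rw [hRpow]
        field_simp
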